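/- **Proposition (Dimensional lower bound).** For an integer $L\ge 0$ let $V_L$ be the real vector space of real signals $f:S^2\to\mathbb{R}$ band-limited at degree $L$, i.e. those of the form $f=\sum_{\ell=0}^{L}\sum_{m=-\ell}^{\ell}a_\ell^m Y_\ell^m$ with $a_\ell^m\in\mathbb{C}$, where $Y_\ell^m$ are the standard spherical harmonics. Let $\mathrm{SO}(3)$ act on signals by $(g\cdot f)(x)=f(g^{-1}x)$. Then $\dim_{\mathbb{R}}V_L=(L+1)^2$, and the following holds. Call a map $\Phi:V_L\to\mathbb{R}^k$ a *complete invariant* if it is smooth ($C^\infty$) or polynomial, satisfies $\Phi(g\cdot f)=\Phi(f)$ for all $g\in\mathrm{SO}(3)$ and $f\in V_L$, and separates orbits on some Zariski-open dense set $U\subseteq V_L$: whenever $f,f'\in U$ and $\Phi(f)=\Phi(f')$, there is $g\in\mathrm{SO}(3)$ with $f'=g\cdot f$. If $\Phi:V_L\to\mathbb{R}^k$ is a complete invariant, then $$k\ \ge\ (L+1)^2-3 .$$ Hence a complete invariant needs $\Omega(L^2)$ components: there are constants $c>0$ and $L_0$ such that for all $L\ge L_0$ every complete invariant $\Phi:V_L\to\mathbb{R}^k$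 has $k\ge cL^2$. -/

import Mathlib

noncomputable section

/-- The unit sphere `S²` in Euclidean three-space. -/
abbrev S2 : Type := Metric.sphere (0 : EuclideanSpace ℝ (Fin 3)) 1

/-- The rotation group `SO(3)`. -/
abbrev SO3 : Type := Matrix.specialOrthogonalGroup (Fin 3) ℝ

/-- The Legendre polynomial `P_ℓ`, by Rodrigues' formula. -/
def legendreP (l : ℕ) : Polynomial ℝ :=
  Polynomial.C (1 / (2 ^ l * (l.factorial : ℝ))) *
    Polynomial.derivative^[l] ((Polynomial.X ^ 2 - 1) ^ l)

/-- The spherical harmonic `Y_ℓ^m` for `0 ≤ m ≤ ℓ`, in Cartesian coordinates. At the point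
`(sin θ cos φ, sin θ sin φ, cos θ)` the factor `(-1)^m P_ℓ^{(m)}(z) (x + i y)^m` is
`P_ℓ^m(cos θ) e^{i m φ}`, with `P_ℓ^m` the associated Legendre function
(Condon-Shortley phase included). -/
def sphHarmNonneg (l m : ℕ) (p : S2) : ℂ :=
  (Real.sqrt ((2 * (l : ℝ) + 1) / (4 * Real.pi) * (((l - m).factorial : ℝ) / ((l + m).factorial : ℝ))) : ℝ) *
    (-1) ^ m * (((Polynomial.derivative^[m] (legendreP l)).eval (p.1 2) : ℝ) : ℂ) *
    ((p.1 0 : ℂ) + Complex.I * (p.1 1 : ℂ)) ^ m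

/-- The spherical harmonic `Y_ℓ^m`, `-ℓ ≤ m ≤ ℓ`, with `Y_ℓ^{-m} = (-1)^m conj (Y_ℓ^m)`. -/
def sphHarm (l : ℕ) (m : ℤ) (p : S2) : ℂ :=
  if 0 ≤ m then sphHarmNonneg l m.natAbs p
  else (-1) ^ m.natAbs * (starRingEnd ℂ) (sphHarmNonneg l m.natAbs p)

/-- The real vector space of real signals on `S²` that are band-limited at degree `L`, that is,
with a spherical harmonic expansion of degree at most `L`. It carries the sup norm. -/
def bandLimited (L : ℕ) : Submodule ℝ C(S2, ℝ) where
  carrier := {f | ∃ a : ℕ → ℤ → ℂ, ∀ p : S2, (f p : ℂ) =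
    ∑ l ∈ Finset.range (L + 1), ∑ m ∈ Finset.Icc (-(l : ℤ)) (l : ℤ), a l m * sphHarm l m p}
  zero_mem' := ⟨fun _ _ => 0, fun p => by simp⟩
  add_mem' := by
    rintro f g ⟨a, ha⟩ ⟨b, hb⟩
    refine ⟨fun l m => a l m + b l m, fun p => ?_⟩
    simp only [ContinuousMap.add_apply, Complex.ofReal_add, ha p, hb p, add_mul,
      Finset.sum_add_distrib]
  smul_mem' := by
    rintro c f ⟨a, ha⟩
    refine ⟨fun l m => (c : ℂ) * a l m, fun p => ?_⟩
    simp only [ContinuousMap.smul_apply, smul_eq_mul, Complex.ofReal_mul, ha p, mul_assoc,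
      Finset.mul_sum]

/-- The action of a rotation on the sphere. -/
def rotatePoint (g : SO3) (p : S2) : S2 :=
  ⟨WithLp.toLp 2 ((g : Matrix (Fin 3) (Fin 3) ℝ).mulVec (WithLp.ofLp p.1)), by
    have hg : (g : Matrix (Fin 3) (Fin 3) ℝ).transpose * (g : Matrix (Fin 3) (Fin 3) ℝ) = 1 :=
      (Matrix.mem_orthogonalGroup_iff' (Fin 3) ℝ).1
        (Matrix.mem_specialOrthogonalGroup_iff.1 g.2).1
    have hp : ‖p.1‖ = 1 := by simp
    rw [mem_sphere_zero_iff_norm, ← sq_eq_sq₀ (norm_nonneg _) zero_le_one,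
      EuclideanSpace.real_norm_sq_eq]
    have hp2 := congrArg (· ^ 2) hp
    simp only [EuclideanSpace.real_norm_sq_eq] at hp2
    refine Eq.trans ?_ hp2
    dsimp only
    have h : ∀ v : Fin 3 → ℝ, ∑ i, v i ^ 2 = v ⬝ᵥ v := fun v => by
      simp [dotProduct, sq]
    rw [h, h, Matrix.dotProduct_mulVec, Matrix.vecMul_mulVec, hg, Matrix.vecMul_one]⟩

theorem continuous_rotatePoint (g : SO3) : Continuous (rotatePoint g) := by
  unfold rotatePoint
  refine Continuous.subtype_mk ?_ _
  refine (PiLp.continuous_toLp 2 _).comp ?_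
  exact Continuous.matrix_mulVec continuous_const
    ((PiLp.continuous_ofLp 2 _).comp continuous_subtype_val)

/-- The action of `SO(3)` on signals: `(g • f)(x) = f (g⁻¹ x)`. -/
def rotate (g : SO3) (f : C(S2, ℝ)) : C(S2, ℝ) :=
  f.comp ⟨rotatePoint g⁻¹, continuous_rotatePoint g⁻¹⟩

/-- The algebra of real polynomial functions on a real vector space: the functions generated by
the linear forms and the constants. -/
def polyFun (V : Type*) [AddCommGroup V] [Module ℝ V] : Subalgebra ℝ (V → ℝ) :=
  Algebra.adjoin ℝ (Set.range fun φ : Module.Dual ℝ V => (φ : V → ℝ))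

/-- The Zariski topology on a real vector space, generated by the non-vanishing sets of
polynomial functions. -/
abbrev zariskiTopology (V : Type*) [AddCommGroup V] [Module ℝ V] : TopologicalSpace V :=
  TopologicalSpace.generateFrom {U | ∃ p ∈ polyFun V, U = {v | p v ≠ 0}}

/-- `Φ` is invariant: it takes the same value on two signals that differ by a rotation. -/
def IsRotationInvariant {L k : ℕ} (Φ : bandLimited L → EuclideanSpace ℝ (Fin k)) : Prop :=
  ∀ (g : SO3) (f f' : bandLimited L), (f' : C(S2, ℝ)) = rotate g f → Φ f' = Φ f

/-- `Φ` separates the `SO(3)`-orbits that meet `U`: signals in `U` with the same value of `Φ`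
differ by a rotation. -/
def SeparatesOrbitsOn {L k : ℕ} (Φ : bandLimited L → EuclideanSpace ℝ (Fin k))
    (U : Set (bandLimited L)) : Prop :=
  ∀ f ∈ U, ∀ f' ∈ U, Φ f = Φ f' → ∃ g : SO3, (f' : C(S2, ℝ)) = rotate g f

/-- A smooth or polynomial complete `SO(3)`-invariant with `k` real components for real signals
of band-limit `L`. -/
structure IsCompleteInvariant (L k : ℕ) (Φ : bandLimited L → EuclideanSpace ℝ (Fin k)) :
    Prop where
  smooth_or_polynomial :
    ContDiff ℝ ((⊤ : ℕ∞) : WithTop ℕ∞) Φ ∨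
      ∀ i : Fin k, (fun f => Φ f i) ∈ polyFun (bandLimited L)
  invariant : IsRotationInvariant Φ
  separates : ∃ U : Set (bandLimited L),
    @IsOpen _ (zariskiTopology (bandLimited L)) U ∧ @Dense _ (zariskiTopology (bandLimited L)) U ∧
      SeparatesOrbitsOn Φ U

end

/-!
At a point of `U` where the rank of `dΦ` is maximal, the rank is locally constant, so some linear
projection onto `ker dΦ`, a space of dimension at least `dim V - k`, maps every neighbourhood of the
point in its fibre onto a neighbourhood. The part of the fibre in `U` lies in a single orbit of
`SO(3)`, which in terms of Euler angles is the image of a `C¹` map on `ℝ³`. By Sard's theorem a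
`C¹` image of `ℝ³` has empty interior in a space of larger dimension, so `dim V - k ≤ 3`.

Complex conjugation permutes the spherical harmonics up to sign, so the real dimension of `V` is
the complex dimension of their span. They are linearly independent: the factors `exp (i m φ)`
separate the orders `m`, and for fixed `m` the remaining factors are `(sin θ) ^ |m|` times
polynomials in `cos θ` of the distinct degrees `l - |m|`.
-/

section ConstantRank

open Filter Module Set Topology

section LinearAlgebra

variable {K V W U : Type*} [DivisionRing K] [AddCommGroup V] [Module K V] [AddCommGroup W]
  [Module K W] [AddCommGroup U] [Module K U]

theorem ker_comp_le_ker_of_finrank_range_le (A : V →ₗ[K] W) (P : W →ₗ[K] U)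
    [FiniteDimensional K A.range]
    (hsurj : Function.Surjective (P ∘ₗ A)) (hrank : finrank K A.range ≤ finrank K U) :
    (P ∘ₗ A).ker ≤ A.ker := by
  have hQ_surj : Function.Surjective (P.domRestrict A.range) := fun u => by
    obtain ⟨v, hv⟩ := hsurj u
    exact ⟨⟨A v, v, rfl⟩, hv⟩
  have : FiniteDimensional K U := Module.Finite.of_surjective _ hQ_surj
  have hQ_inj : Function.Injective (P.domRestrict A.range) :=
    (LinearMap.injective_iff_surjective_of_finrank_eq_finrank
      (hrank.antisymm (LinearMap.finrank_le_finrank_of_surjective hQ_surj))).2 hQ_surj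
  intro v hv
  exact congrArg Subtype.val
    (hQ_inj (a₁ := ⟨A v, v, rfl⟩) (a₂ := 0) (hv.trans (map_zero _).symm))

end LinearAlgebra

section Fibres

variable {E F G H : Type*}
  [NormedAddCommGroup E] [NormedSpace ℝ E] [NormedAddCommGroup F] [NormedSpace ℝ F]
  [NormedAddCommGroup G] [NormedSpace ℝ G] [NormedAddCommGroup H] [NormedSpace ℝ H]

theorem eventually_eq_of_eventually_hasFDerivAt_zero {f : E → F} {x : E}
    (h : ∀ᶠ y in 𝓝 x, HasFDerivAt f (0 : E →L[ℝ] F) y) : ∀ᶠ y in 𝓝 x, f y = f x := by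
  obtain ⟨ε, hε, hball⟩ := Metric.eventually_nhds_iff_ball.1 h
  filter_upwards [Metric.ball_mem_nhds x hε] with y hy
  exact (convex_ball x ε).is_const_of_fderivWithin_eq_zero (𝕜 := ℝ)
    (fun z hz => (hball z hz).differentiableAt.differentiableWithinAt)
    (fun z hz => (hball z hz).hasFDerivWithinAt.fderivWithin
      (Metric.isOpen_ball.uniqueDiffWithinAt hz)) hy (Metric.mem_ball_self hε)

variable [CompleteSpace E] [CompleteSpace F] [CompleteSpace G]

theorem map_rightFun_nhdsWithin_fibre (φ : ImplicitFunctionData ℝ E F G) :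
    map φ.rightFun (𝓝[φ.leftFun ⁻¹' {φ.leftFun φ.pt}] φ.pt) = 𝓝 (φ.rightFun φ.pt) := by
  have hmap := φ.map_implicitFunction_nhdsWithin_preimage univ
  rw [preimage_univ, nhdsWithin_univ, univ_inter] at hmap
  have hright : φ.rightFun ∘ φ.implicitFunction (φ.leftFun φ.pt) =ᶠ[𝓝 (φ.rightFun φ.pt)] id :=
    φ.rightFun_implicitFunction.curry_nhds.self_of_nhds
  rw [← hmap, map_map, map_congr hright, map_id]

theorem eventually_eq_on_fibre_of_ker_fderiv_le (φ : ImplicitFunctionData ℝ E F G)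
    (hleft : ContDiffAt ℝ 1 φ.leftFun φ.pt) (hright : ContDiffAt ℝ 1 φ.rightFun φ.pt) {Φ : E → H}
    (hΦ : ∀ᶠ y in 𝓝 φ.pt, DifferentiableAt ℝ Φ y)
    (hker : ∀ᶠ y in 𝓝 φ.pt, (fderiv ℝ φ.leftFun y).ker ≤ (fderiv ℝ Φ y).ker) :
    ∀ᶠ y in 𝓝[φ.leftFun ⁻¹' {φ.leftFun φ.pt}] φ.pt, Φ y = Φ φ.pt := by
  have hmap := φ.map_implicitFunction_nhdsWithin_preimage univ
  rw [preimage_univ, nhdsWithin_univ, univ_inter] at hmap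
  set ψ := φ.implicitFunction (φ.leftFun φ.pt)
  have hψ_pt : ψ (φ.rightFun φ.pt) = φ.pt := φ.implicitFunction_apply_image.self_of_nhds
  have hψ : ContDiffAt ℝ 1 ψ (φ.rightFun φ.pt) :=
    (φ.contDiffAt_implicitFunction hleft hright one_ne_zero).comp (φ.rightFun φ.pt)
      (contDiffAt_const.prodMk contDiffAt_id)
  have hψ_tendsto : Tendsto ψ (𝓝 (φ.rightFun φ.pt)) (𝓝 φ.pt) := by
    simpa only [ContinuousAt, hψ_pt] using hψ.continuousAt
  have hψ_left : ∀ᶠ z in 𝓝 (φ.rightFun φ.pt), φ.leftFun (ψ z) = φ.leftFun φ.pt :=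
    φ.leftFun_implicitFunction.curry_nhds.self_of_nhds
  have hleft_diff : ∀ᶠ y in 𝓝 φ.pt, DifferentiableAt ℝ φ.leftFun y :=
    (hleft.eventually (by simp)).mono fun y hy => hy.differentiableAt one_ne_zero
  have hzero : ∀ᶠ z in 𝓝 (φ.rightFun φ.pt), HasFDerivAt (Φ ∘ ψ) (0 : G →L[ℝ] H) z := by
    filter_upwards [hψ.eventually (by simp), hψ_left.eventually_nhds,
      hψ_tendsto.eventually hleft_diff, hψ_tendsto.eventually hΦ, hψ_tendsto.eventually hker]
      with z hψz hconst hleftz hΦz hkerz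
    have hψ' := (hψz.differentiableAt one_ne_zero).hasFDerivAt
    have hleft_zero : (fderiv ℝ φ.leftFun (ψ z)).comp (fderiv ℝ ψ z) = 0 :=
      (hleftz.hasFDerivAt.comp z hψ').unique
        ((hasFDerivAt_const (φ.leftFun φ.pt) z).congr_of_eventuallyEq hconst)
    refine (hΦz.hasFDerivAt.comp z hψ').congr_fderiv (ContinuousLinearMap.ext fun v => ?_)
    exact hkerz (DFunLike.congr_fun hleft_zero v)
  rw [← hmap, eventually_map]
  simpa only [Function.comp_apply, hψ_pt] using eventually_eq_of_eventually_hasFDerivAt_zero hzero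

end Fibres

section Rank

variable {𝕜 E F : Type*} [NontriviallyNormedField 𝕜] [CompleteSpace 𝕜] [NormedAddCommGroup E]
  [NormedSpace 𝕜 E] [NormedAddCommGroup F] [NormedSpace 𝕜 F] [FiniteDimensional 𝕜 F]

theorem eventually_surjective {A : E →L[𝕜] F} (hA : Function.Surjective A) :
    ∀ᶠ B : E →L[𝕜] F in 𝓝 A, Function.Surjective B := by
  have : CompleteSpace F := FiniteDimensional.complete 𝕜 F
  obtain ⟨S, hS⟩ := A.exists_rightInverse_of_surjective (LinearMap.range_eq_top.2 hA)
  have hunit : IsUnit (A.comp S : F →L[𝕜] F) := hS ▸ isUnit_one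
  have hcont : Continuous fun B : E →L[𝕜] F => B.comp S := continuous_id.clm_comp continuous_const
  filter_upwards [hcont.continuousAt (Units.isOpen.mem_nhds hunit)] with B hB
  exact .of_comp (ContinuousLinearMap.isUnit_iff_bijective.1 hB).surjective

theorem eventually_ker_comp_le_ker {A : E →L[𝕜] F} {P : F →L[𝕜] A.range}
    (hP : ∀ w : A.range, P w = w) :
    ∀ᶠ B : E →L[𝕜] F in 𝓝 A, finrank 𝕜 B.range ≤ finrank 𝕜 A.range →
      (P.comp B).ker ≤ B.ker := by
  have hsurj : Function.Surjective (P.comp A) := fun w => by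
    obtain ⟨v, hv⟩ := w.2
    exact ⟨v, (congrArg P hv).trans (hP w)⟩
  have hcont : Continuous fun B : E →L[𝕜] F => P.comp B := continuous_const.clm_comp continuous_id
  filter_upwards [hcont.continuousAt.eventually (eventually_surjective hsurj)] with B hB hrank
  exact ker_comp_le_ker_of_finrank_range_le B.toLinearMap P.toLinearMap hB hrank

end Rank

section MaximalRank

variable {E F : Type*} [NormedAddCommGroup E] [NormedSpace ℝ E] [NormedAddCommGroup F]
  [NormedSpace ℝ F] [FiniteDimensional ℝ F]

theorem exists_nhds_le_map_nhdsWithin_fibre [CompleteSpace E] {Φ : E → F} {x : E}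
    (hΦ : ContDiffAt ℝ 1 Φ x)
    (hrank : ∀ᶠ y in 𝓝 x, finrank ℝ (fderiv ℝ Φ y).range ≤ finrank ℝ (fderiv ℝ Φ x).range) :
    ∃ π : E →L[ℝ] (fderiv ℝ Φ x).ker, 𝓝 (π x) ≤ map π (𝓝[Φ ⁻¹' {Φ x}] x) := by
  have hdiff : ∀ᶠ y in 𝓝 x, DifferentiableAt ℝ Φ y :=
    (hΦ.eventually (by simp)).mono fun y hy => hy.differentiableAt one_ne_zero
  obtain ⟨P, hP⟩ := Submodule.ClosedComplemented.of_finiteDimensional (fderiv ℝ Φ x).range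
  obtain ⟨π, hπ⟩ := (fderiv ℝ Φ x).ker_closedComplemented_of_finiteDimensional_range
  have hP_apply : ∀ v, P (fderiv ℝ Φ x v) = ⟨fderiv ℝ Φ x v, v, rfl⟩ := fun v => hP ⟨_, v, rfl⟩
  have hP_ker : (P.comp (fderiv ℝ Φ x)).ker = (fderiv ℝ Φ x).ker := by
    ext v
    exact (congrArg (· = 0) (hP_apply v)).to_iff.trans Subtype.ext_iff
  -- `P ∘ Φ` is a submersion at `x`, and by maximality of the rank `d(P ∘ Φ)` and `dΦ` have the
  -- same kernel nearby, so that `Φ` is locally constant on the fibre of `P ∘ Φ`.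
  let φ : ImplicitFunctionData ℝ E (fderiv ℝ Φ x).range (fderiv ℝ Φ x).ker :=
    { leftFun := P ∘ Φ
      leftDeriv := P.comp (fderiv ℝ Φ x)
      rightFun := π
      rightDeriv := π
      pt := x
      hasStrictFDerivAt_leftFun := P.hasStrictFDerivAt.comp x (hΦ.hasStrictFDerivAt one_ne_zero)
      hasStrictFDerivAt_rightFun := π.hasStrictFDerivAt
      range_leftDeriv :=
        LinearMap.range_eq_top.2 fun ⟨_, v, hv⟩ => ⟨v, (hP_apply v).trans (Subtype.ext hv)⟩
      range_rightDeriv := LinearMap.range_eq_top.2 fun v => ⟨v, hπ v⟩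
      isCompl_ker := by
        rw [hP_ker]
        exact LinearMap.isCompl_of_proj hπ }
  have hker : ∀ᶠ y in 𝓝 x, (fderiv ℝ φ.leftFun y).ker ≤ (fderiv ℝ Φ y).ker := by
    filter_upwards [hdiff, hrank, (hΦ.continuousAt_fderiv one_ne_zero).eventually
      (eventually_ker_comp_le_ker hP)] with y hy hrank_y hker_y
    rw [(P.hasFDerivAt.comp y hy.hasFDerivAt).fderiv]
    exact hker_y hrank_y
  have hfibre : ∀ᶠ y in 𝓝[φ.leftFun ⁻¹' {φ.leftFun x}] x, Φ y = Φ x :=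
    eventually_eq_on_fibre_of_ker_fderiv_le φ (P.contDiff.contDiffAt.comp x hΦ)
      π.contDiff.contDiffAt hdiff hker
  exact ⟨π, (map_rightFun_nhdsWithin_fibre φ).ge.trans
    (map_mono (le_inf inf_le_left (le_principal_iff.2 hfibre)))⟩

theorem finrank_le_of_fibre_subset_range [FiniteDimensional ℝ E] {P : Type*}
    [NormedAddCommGroup P] [NormedSpace ℝ P] [FiniteDimensional ℝ P] {Φ : E → F} {U : Set E}
    (hU : IsOpen U) (hne : U.Nonempty) (hΦ : ContDiffOn ℝ 1 Φ U)
    (hfibre : ∀ x ∈ U, ∃ Γ : P → E, ContDiff ℝ 1 Γ ∧ U ∩ Φ ⁻¹' {Φ x} ⊆ range Γ) :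
    finrank ℝ E ≤ finrank ℝ F + finrank ℝ P := by
  have hbdd : BddAbove ((fun y => finrank ℝ (fderiv ℝ Φ y).range) '' U) :=
    ⟨finrank ℝ F, forall_mem_image.2 fun y _ => Submodule.finrank_le _⟩
  obtain ⟨x, hxU, hx⟩ := Nat.sSup_mem (hne.image _) hbdd
  have hrank : ∀ᶠ y in 𝓝 x,
      finrank ℝ (fderiv ℝ Φ y).range ≤ finrank ℝ (fderiv ℝ Φ x).range := by
    filter_upwards [hU.mem_nhds hxU] with y hy
    exact (le_csSup hbdd (mem_image_of_mem _ hy)).trans_eq hx.symm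
  obtain ⟨π, hπ⟩ := exists_nhds_le_map_nhdsWithin_fibre (hΦ.contDiffAt (hU.mem_nhds hxU)) hrank
  obtain ⟨Γ, hΓ, hsub⟩ := hfibre x hxU
  have himage : range (π ∘ Γ) ∈ 𝓝 (π x) := by
    refine mem_of_superset (hπ (image_mem_map (inter_mem_nhdsWithin _ (hU.mem_nhds hxU)))) ?_
    rw [range_comp, inter_comm]
    exact image_mono hsub
  have hker : finrank ℝ (fderiv ℝ Φ x).ker ≤ finrank ℝ P := by
    by_contra! hlt
    obtain ⟨y, hy, hy'⟩ := ((π.contDiff.comp hΓ).dense_compl_range_of_finrank_lt_finrank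
      hlt).inter_nhds_nonempty himage
    exact hy hy'
  calc finrank ℝ E = finrank ℝ (fderiv ℝ Φ x).range + finrank ℝ (fderiv ℝ Φ x).ker :=
        (LinearMap.finrank_range_add_finrank_ker (fderiv ℝ Φ x).toLinearMap).symm
    _ ≤ finrank ℝ F + finrank ℝ P := add_le_add (Submodule.finrank_le _) hker

end MaximalRank

end ConstantRank

noncomputable section

section Polynomials

theorem contDiff_of_mem_polyFun {V : Type*} [NormedAddCommGroup V] [NormedSpace ℝ V]
    [FiniteDimensional ℝ V] {n : WithTop ℕ∞} {p : V → ℝ} (hp : p ∈ polyFun V) :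
    ContDiff ℝ n p := by
  induction hp using Algebra.adjoin_induction with
  | mem p hp =>
    obtain ⟨φ, rfl⟩ := hp
    exact φ.toContinuousLinearMap.contDiff
  | algebraMap r => exact contDiff_const
  | add p q _ _ hp hq => exact hp.add hq
  | mul p q _ _ hp hq => exact hp.mul hq

theorem isOpen_of_isOpen_zariski {V : Type*} [NormedAddCommGroup V] [NormedSpace ℝ V]
    [FiniteDimensional ℝ V] {U : Set V} (hU : @IsOpen _ (zariskiTopology V) U) : IsOpen U := by
  refine (le_generateFrom ?_ : _ ≤ zariskiTopology V) U hU
  rintro _ ⟨p, hp, rfl⟩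
  exact isOpen_ne.preimage (contDiff_of_mem_polyFun (n := 0) hp).continuous

end Polynomials

section Rotations

open Real

theorem rotatePoint_apply (g : SO3) (p : S2) (i : Fin 3) :
    (rotatePoint g p).1 i = ∑ j, (g : Matrix (Fin 3) (Fin 3) ℝ) i j * p.1 j := rfl

theorem rotatePoint_mul (g h : SO3) (p : S2) :
    rotatePoint (g * h) p = rotatePoint g (rotatePoint h p) :=
  Subtype.ext (congrArg (WithLp.toLp 2) (Matrix.mulVec_mulVec _ _ _).symm)

theorem rotatePoint_one (p : S2) : rotatePoint 1 p = p :=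
  Subtype.ext (congrArg (WithLp.toLp 2) (Matrix.one_mulVec _))

/-- Rotation by the angle `a` about the third axis. -/
def rotZ (a : ℝ) : SO3 :=
  ⟨!![cos a, -sin a, 0; sin a, cos a, 0; 0, 0, 1], by
    rw [Matrix.mem_specialOrthogonalGroup_iff, Matrix.mem_orthogonalGroup_iff]
    constructor
    · ext i j
      fin_cases i <;> fin_cases j <;> simp [Matrix.mul_apply, Fin.sum_univ_three, ← sq, mul_comm]
    · simp [Matrix.det_fin_three, ← sq]⟩

/-- Rotation by the angle `b` about the second axis. -/
def rotY (b : ℝ) : SO3 :=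
  ⟨!![cos b, 0, sin b; 0, 1, 0; -sin b, 0, cos b], by
    rw [Matrix.mem_specialOrthogonalGroup_iff, Matrix.mem_orthogonalGroup_iff]
    constructor
    · ext i j
      fin_cases i <;> fin_cases j <;> simp [Matrix.mul_apply, Fin.sum_univ_three, ← sq, mul_comm]
    · simp [Matrix.det_fin_three, ← sq]⟩

/-- The point `(0, 0, 1)` of the sphere. -/
def northPole : S2 := ⟨EuclideanSpace.single 2 1, by simp⟩

/-- The point of the sphere with longitude `φ` and colatitude `θ`. -/
def sphericalPoint (φ θ : ℝ) : S2 := rotatePoint (rotZ φ * rotY θ) northPole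

theorem rotatePoint_northPole_apply (g : SO3) (i : Fin 3) :
    (rotatePoint g northPole).1 i = (g : Matrix (Fin 3) (Fin 3) ℝ) i 2 := by
  simp [rotatePoint_apply, northPole]

theorem sphericalPoint_coe (φ θ : ℝ) :
    (sphericalPoint φ θ : EuclideanSpace ℝ (Fin 3)) =
      !₂[sin θ * cos φ, sin θ * sin φ, cos θ] := by
  ext i
  rw [sphericalPoint, rotatePoint_northPole_apply]
  fin_cases i <;> simp [rotZ, rotY, mul_comm]

theorem exists_cos_eq_sin_eq {x y : ℝ} (h : x ^ 2 + y ^ 2 = 1) : ∃ a, cos a = x ∧ sin a = y := by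
  have hn : ‖(⟨x, y⟩ : ℂ)‖ = 1 := by
    rw [← sq_eq_sq₀ (norm_nonneg _) zero_le_one, Complex.sq_norm, Complex.normSq_mk]
    linarith
  refine ⟨Complex.arg ⟨x, y⟩, ?_, ?_⟩
  · simpa [hn] using Complex.norm_mul_cos_arg ⟨x, y⟩
  · simpa [hn] using Complex.norm_mul_sin_arg ⟨x, y⟩

theorem exists_sphericalPoint_eq (p : S2) : ∃ φ θ, sphericalPoint φ θ = p := by
  set w : ℂ := ⟨p.1 0, p.1 1⟩
  have hp : ‖w‖ ^ 2 + p.1 2 ^ 2 = 1 := by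
    have hnorm := EuclideanSpace.real_norm_sq_eq p.1
    rw [norm_eq_of_mem_sphere p, Fin.sum_univ_three] at hnorm
    rw [Complex.sq_norm, Complex.normSq_mk]
    linarith
  obtain ⟨θ, hcos, hsin⟩ := exists_cos_eq_sin_eq ((add_comm _ _).trans hp)
  refine ⟨w.arg, θ, Subtype.ext ?_⟩
  rw [sphericalPoint_coe, hcos, hsin, Complex.norm_mul_cos_arg, Complex.norm_mul_sin_arg]
  ext i
  fin_cases i <;> rfl

theorem transpose_eq_adjugate (g : SO3) :
    (g : Matrix (Fin 3) (Fin 3) ℝ).transpose = (g : Matrix (Fin 3) (Fin 3) ℝ).adjugate := by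
  obtain ⟨M, hM⟩ := g
  obtain ⟨hM_orth, hdet⟩ := Matrix.mem_specialOrthogonalGroup_iff.1 hM
  have hleft : M.transpose * M = 1 := (Matrix.mem_orthogonalGroup_iff' _ _).1 hM_orth
  calc M.transpose = M.transpose * M * M.adjugate := by
        rw [mul_assoc, Matrix.mul_adjugate, hdet, one_smul, mul_one]
    _ = M.adjugate := by
        rw [hleft, one_mul]

theorem exists_rotZ_eq_of_rotatePoint_northPole {g : SO3}
    (hg : rotatePoint g northPole = northPole) : ∃ c, rotZ c = g := by
  have hcol (i : Fin 3) : (g : Matrix (Fin 3) (Fin 3) ℝ) i 2 = northPole.1 i := by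
    rw [← rotatePoint_northPole_apply, hg]
  have hadj (i j : Fin 3) := congrFun₂ (transpose_eq_adjugate g) i j
  have hdet := (Matrix.mem_specialOrthogonalGroup_iff.1 g.2).2
  obtain ⟨N, hN⟩ := g
  have h02 : N 0 2 = 0 := by simpa [northPole] using hcol 0
  have h12 : N 1 2 = 0 := by simpa [northPole] using hcol 1
  have h22 : N 2 2 = 1 := by simpa [northPole] using hcol 2
  have h00 : N 0 0 = N 1 1 := by simpa [Matrix.adjugate_fin_three, h12, h22] using hadj 0 0
  have h10 : N 1 0 = -N 0 1 := by simpa [Matrix.adjugate_fin_three, h02, h22] using hadj 0 1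
  have h20 : N 2 0 = 0 := by simpa [Matrix.adjugate_fin_three, h02, h12] using hadj 0 2
  have h21 : N 2 1 = 0 := by simpa [Matrix.adjugate_fin_three, h02, h12] using hadj 1 2
  have hsq : N 1 1 ^ 2 + N 0 1 ^ 2 = 1 := by
    simpa [Matrix.det_fin_three, h02, h12, h22, h20, h21, h00, h10, ← sq] using hdet
  obtain ⟨c, hcos, hsin⟩ := exists_cos_eq_sin_eq ((congrArg _ (neg_sq (N 0 1))).trans hsq)
  refine ⟨c, Subtype.ext (Matrix.ext fun i j => ?_)⟩
  fin_cases i <;> fin_cases j <;> simp [rotZ, *]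

theorem exists_eq_rotZ_mul_rotY_mul_rotZ (g : SO3) :
    ∃ a b c, g = rotZ a * rotY b * rotZ c := by
  obtain ⟨a, b, hab⟩ := exists_sphericalPoint_eq (rotatePoint g northPole)
  obtain ⟨c, hc⟩ := exists_rotZ_eq_of_rotatePoint_northPole (g := (rotZ a * rotY b)⁻¹ * g) (by
    rw [rotatePoint_mul, ← hab, sphericalPoint, ← rotatePoint_mul, inv_mul_cancel,
      rotatePoint_one])
  exact ⟨a, b, c, by rw [hc, mul_inv_cancel_left]⟩

theorem contDiff_rotZ_apply {n : WithTop ℕ∞} (i j : Fin 3) :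
    ContDiff ℝ n fun a => (rotZ a : Matrix (Fin 3) (Fin 3) ℝ) i j := by
  fin_cases i <;> fin_cases j <;>
    simp [rotZ, contDiff_cos, contDiff_sin, contDiff_const, ContDiff.neg]

theorem contDiff_rotY_apply {n : WithTop ℕ∞} (i j : Fin 3) :
    ContDiff ℝ n fun b => (rotY b : Matrix (Fin 3) (Fin 3) ℝ) i j := by
  fin_cases i <;> fin_cases j <;>
    simp [rotY, contDiff_cos, contDiff_sin, contDiff_const, ContDiff.neg]

theorem contDiff_rotatePoint_rotZ_mul_rotY_mul_rotZ {n : WithTop ℕ∞} (p : S2) :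
    ContDiff ℝ n fun t : ℝ × ℝ × ℝ =>
      (rotatePoint (rotZ t.1 * rotY t.2.1 * rotZ t.2.2) p : EuclideanSpace ℝ (Fin 3)) := by
  refine contDiff_euclidean.2 fun i => ?_
  simp only [rotatePoint_apply, Submonoid.coe_mul, Matrix.mul_apply]
  refine ContDiff.sum fun j _ => ContDiff.mul ?_ contDiff_const
  refine ContDiff.sum fun k _ => ContDiff.mul (ContDiff.sum fun l _ => ContDiff.mul ?_ ?_) ?_
  · exact (contDiff_rotZ_apply i l).comp contDiff_fst
  · exact (contDiff_rotY_apply l k).comp (contDiff_fst.comp contDiff_snd)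
  · exact (contDiff_rotZ_apply k j).comp (contDiff_snd.comp contDiff_snd)

end Rotations

section LinearIndependence

open Module Polynomial

theorem linearIndependent_sigma_mul {K Y Z μ : Type*} [CommRing K] {ι : μ → Type*}
    {g : μ → Y → K} {h : ∀ m, ι m → Z → K} (hg : LinearIndependent K g)
    (hh : ∀ m, LinearIndependent K (h m)) :
    LinearIndependent K fun (x : Σ m, ι m) (p : Y × Z) => g x.1 p.1 * h x.1 x.2 p.2 := by
  classical
  refine linearIndependent_iff'.2 fun s c hc x hx => ?_
  let t (m : μ) : Finset (ι m) := s.preimage (Sigma.mk m) sigma_mk_injective.injOn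
  have hst : (s.image Sigma.fst).sigma t = s := Finset.sigma_image_fst_preimage_mk s
  have hcoeff (z : Z) : ∀ m ∈ s.image Sigma.fst, ∑ i ∈ t m, c ⟨m, i⟩ * h m i z = 0 := by
    refine linearIndependent_iff'.1 hg _ _ (funext fun y => ?_)
    have hyz := congrFun hc (y, z)
    rw [← hst, Finset.sum_sigma] at hyz
    simpa [Finset.sum_apply, Finset.sum_mul, mul_assoc, mul_comm (g _ y)] using hyz
  refine linearIndependent_iff'.1 (hh x.1) (t x.1) (fun i => c ⟨x.1, i⟩) (funext fun z => ?_) x.2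
    (Finset.mem_preimage.2 hx)
  simpa [Finset.sum_apply] using hcoeff z x.1 (Finset.mem_image_of_mem _ hx)

theorem linearIndependent_exp_int_mul_I :
    LinearIndependent ℂ fun (m : ℤ) (φ : ℝ) => Complex.exp (φ * Complex.I) ^ m := by
  have : Fact (0 < 2 * Real.pi) := ⟨Real.two_pi_pos⟩
  have hfourier : LinearIndependent ℂ (fourier : ℤ → C(AddCircle (2 * Real.pi), ℂ)) :=
    .of_comp (ContinuousMap.toLp (E := ℂ) 2 AddCircle.haarAddCircle ℂ).toLinearMap
      orthonormal_fourier.linearIndependent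
  let T : C(AddCircle (2 * Real.pi), ℂ) →ₗ[ℂ] (ℝ → ℂ) :=
    LinearMap.funLeft ℂ ℂ (↑) ∘ₗ ContinuousMap.coeFnLinearMap ℂ
  have hT (m : ℤ) (φ : ℝ) : T (fourier m) φ = Complex.exp (φ * Complex.I) ^ m := by
    rw [← Complex.exp_int_mul]
    refine fourier_coe_apply.trans (congrArg Complex.exp ?_)
    have := Complex.ofReal_ne_zero.2 Real.pi_ne_zero
    push_cast
    field_simp
  have hinj : Function.Injective T :=
    (LinearMap.funLeft_injective_of_surjective ℂ ℂ _ Quotient.mk_surjective).comp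
      DFunLike.coe_injective
  exact (funext₂ hT) ▸ hfourier.map' T (LinearMap.ker_eq_bot.2 hinj)

theorem degree_iterate_derivative {R : Type*} [Semiring R] [IsAddTorsionFree R] {p : R[X]}
    {k n : ℕ} (hp : p.degree = (k + n : ℕ)) : (derivative^[n] p).degree = k := by
  induction n generalizing p with
  | zero => exact hp
  | succ n ih =>
    have hnat : p.natDegree = k + n + 1 := natDegree_eq_of_degree_eq_some hp
    rw [Function.iterate_succ_apply]
    exact ih (by rw [degree_derivative (by omega), hnat, Nat.add_sub_cancel])

theorem degree_legendreP (l : ℕ) : (legendreP l).degree = l := by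
  have hbase : ((X ^ 2 - 1 : ℝ[X]) ^ l).degree = (l + l : ℕ) := by
    rw [degree_pow, ← C_1, degree_X_pow_sub_C two_pos, nsmul_eq_mul, ← mul_two,
      Nat.cast_mul]
  rw [legendreP, degree_C_mul (by positivity), degree_iterate_derivative hbase]

/-- The polynomials `P_n^{(n)}, P_{n+1}^{(n)}, …`, one in each degree, with complex
coefficients. -/
def legendreDerivative (n : ℕ) : Polynomial.Sequence ℂ where
  elems' k := (derivative^[n] (legendreP (n + k))).map Complex.ofRealHom
  degree_eq' k := by
    rw [degree_map]
    exact degree_iterate_derivative (by rw [degree_legendreP, add_comm])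

theorem legendreDerivative_eval_ofReal (n k : ℕ) (z : ℝ) :
    (legendreDerivative n k).eval (z : ℂ) = (derivative^[n] (legendreP (n + k))).eval z :=
  eval_map_apply Complex.ofRealHom z

theorem eq_zero_of_eval_cos_mul_sin_pow_eq_zero {q : ℂ[X]} {n : ℕ}
    (hq : ∀ θ : ℝ, q.eval (Real.cos θ : ℂ) * (Real.sin θ : ℂ) ^ n = 0) : q = 0 := by
  refine eq_zero_of_infinite_isRoot q (((Set.Ioo_infinite (neg_lt_self one_pos)).image
    Complex.ofReal_injective.injOn).mono (s := Complex.ofReal '' Set.Ioo (-1 : ℝ) 1) ?_)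
  rintro _ ⟨z, hz, rfl⟩
  have hsin : (Real.sin (Real.arccos z) : ℂ) ≠ 0 := by
    rw [Real.sin_arccos, Complex.ofReal_ne_zero, Real.sqrt_ne_zero']
    nlinarith [hz.1, hz.2]
  have := (mul_eq_zero.1 (hq (Real.arccos z))).resolve_right (pow_ne_zero n hsin)
  rwa [Real.cos_arccos hz.1.le hz.2.le] at this

theorem linearIndependent_legendreDerivative_cos_mul_sin_pow (n : ℕ) :
    LinearIndependent ℂ fun (k : ℕ) (θ : ℝ) =>
      (legendreDerivative n k).eval (Real.cos θ : ℂ) * (Real.sin θ : ℂ) ^ n := by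
  let T : ℂ[X] →ₗ[ℂ] (ℝ → ℂ) :=
    LinearMap.pi fun θ => (Real.sin θ : ℂ) ^ n • Polynomial.leval (Real.cos θ : ℂ)
  have hT (q : ℂ[X]) (θ : ℝ) : T q θ = q.eval (Real.cos θ : ℂ) * (Real.sin θ : ℂ) ^ n :=
    mul_comm _ _
  have hker : LinearMap.ker T = ⊥ := LinearMap.ker_eq_bot'.2 fun q hq =>
    eq_zero_of_eval_cos_mul_sin_pow_eq_zero (n := n) fun θ => by rw [← hT, hq, Pi.zero_apply]
  exact (funext₂ fun k => hT (legendreDerivative n k)) ▸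
    (legendreDerivative n).linearIndependent.map' T hker

end LinearIndependence

section SphericalHarmonics

open Real

/-- The factor of `Y_l^m` that does not depend on the point: the normalization and the
Condon-Shortley phase, which is trivial for `m < 0`. -/
def sphHarmConst (l : ℕ) (m : ℤ) : ℝ :=
  √((2 * (l : ℝ) + 1) / (4 * π) * (((l - m.natAbs).factorial : ℝ) / (l + m.natAbs).factorial)) *
    (-1) ^ m.toNat

theorem sphHarmConst_ne_zero (l : ℕ) (m : ℤ) : sphHarmConst l m ≠ 0 := by
  refine mul_ne_zero (sqrt_ne_zero'.2 ?_) (pow_ne_zero _ (neg_ne_zero.2 one_ne_zero))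
  positivity

theorem sphHarmConst_neg_natCast (l n : ℕ) :
    sphHarmConst l (-n) = (-1) ^ n * sphHarmConst l n := by
  have hsq : (-1 : ℝ) ^ n * (-1) ^ n = 1 := by rw [← mul_pow, neg_one_mul, neg_neg, one_pow]
  simp only [sphHarmConst, Int.natAbs_neg, Int.natAbs_natCast, Int.toNat_neg_natCast, pow_zero,
    Int.toNat_natCast]
  linear_combination -√((2 * (l : ℝ) + 1) / (4 * π) *
    (((l - n).factorial : ℝ) / (l + n).factorial)) * hsq

theorem sphHarmNonneg_sphericalPoint (l m : ℕ) (φ θ : ℝ) :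
    sphHarmNonneg l m (sphericalPoint φ θ) = sphHarmConst l m *
      ((Polynomial.derivative^[m] (legendreP l)).eval (cos θ) : ℝ) * (sin θ : ℂ) ^ m *
        Complex.exp (φ * Complex.I) ^ m := by
  have hxy : ((sin θ * cos φ : ℝ) : ℂ) + Complex.I * (sin θ * sin φ : ℝ) =
      sin θ * Complex.exp (φ * Complex.I) := by
    rw [Complex.exp_mul_I]
    push_cast
    ring
  have hcoord : (sphericalPoint φ θ).1 = !₂[sin θ * cos φ, sin θ * sin φ, cos θ] :=
    sphericalPoint_coe φ θ
  simp only [sphHarmNonneg, hcoord, PiLp.toLp_apply, Matrix.cons_val, hxy, mul_pow, sphHarmConst,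
    Int.natAbs_natCast, Int.toNat_natCast]
  push_cast
  ring

theorem sphHarm_sphericalPoint (l : ℕ) (m : ℤ) (φ θ : ℝ) :
    sphHarm l m (sphericalPoint φ θ) = sphHarmConst l m *
      ((Polynomial.derivative^[m.natAbs] (legendreP l)).eval (cos θ) : ℝ) *
        (sin θ : ℂ) ^ m.natAbs * Complex.exp (φ * Complex.I) ^ m := by
  rcases le_or_gt 0 m with hm | hm
  · lift m to ℕ using hm
    rw [sphHarm, if_pos (Int.natCast_nonneg m), sphHarmNonneg_sphericalPoint]
    rfl
  · obtain ⟨n, rfl⟩ : ∃ n : ℕ, m = -n := ⟨m.natAbs, by omega⟩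
    have hconj : (starRingEnd ℂ) (Complex.exp (φ * Complex.I)) =
        (Complex.exp (φ * Complex.I))⁻¹ := by
      rw [← Complex.exp_conj, ← Complex.exp_neg, map_mul, Complex.conj_ofReal, Complex.conj_I,
        mul_neg]
    rw [sphHarm, if_neg hm.not_ge, Int.natAbs_neg, Int.natAbs_natCast,
      sphHarmNonneg_sphericalPoint, sphHarmConst_neg_natCast]
    simp only [map_mul, map_pow, Complex.conj_ofReal, hconj, zpow_neg, zpow_natCast, inv_pow]
    push_cast
    ring

theorem linearIndependent_sphHarm_natAbs_add :
    LinearIndependent ℂ fun x : Σ _ : ℤ, ℕ => sphHarm (x.1.natAbs + x.2) x.1 := by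
  have hθ (m : ℤ) : LinearIndependent ℂ fun (k : ℕ) (θ : ℝ) =>
      (sphHarmConst (m.natAbs + k) m : ℂ) *
        ((legendreDerivative m.natAbs k).eval (cos θ : ℂ) * (sin θ : ℂ) ^ m.natAbs) :=
    (linearIndependent_legendreDerivative_cos_mul_sin_pow m.natAbs).units_smul fun k =>
      Units.mk0 _ (Complex.ofReal_ne_zero.2 (sphHarmConst_ne_zero (m.natAbs + k) m))
  have hsplit (x : Σ _ : ℤ, ℕ) (p : ℝ × ℝ) :
      sphHarm (x.1.natAbs + x.2) x.1 (sphericalPoint p.1 p.2) =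
        Complex.exp (p.1 * Complex.I) ^ x.1 * ((sphHarmConst (x.1.natAbs + x.2) x.1 : ℂ) *
          ((legendreDerivative x.1.natAbs x.2).eval (cos p.2 : ℂ) *
            (sin p.2 : ℂ) ^ x.1.natAbs)) := by
    rw [sphHarm_sphericalPoint, legendreDerivative_eval_ofReal]
    ring
  have hprod := linearIndependent_sigma_mul linearIndependent_exp_int_mul_I hθ
  rw [← funext₂ hsplit] at hprod
  exact .of_comp (LinearMap.funLeft ℂ ℂ fun p : ℝ × ℝ => sphericalPoint p.1 p.2) hprod

theorem linearIndepOn_sphHarm :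
    LinearIndepOn ℂ (fun x : (_ : ℕ) × ℤ => sphHarm x.1 x.2) {x | x.2.natAbs ≤ x.1} := by
  let e (x : {x : (_ : ℕ) × ℤ | x.2.natAbs ≤ x.1}) : Σ _ : ℤ, ℕ := ⟨x.1.2, x.1.1 - x.1.2.natAbs⟩
  have hdegree (x : {x : (_ : ℕ) × ℤ | x.2.natAbs ≤ x.1}) :
      (e x).1.natAbs + (e x).2 = x.1.1 := Nat.add_sub_cancel' x.2
  have he : Function.Injective e := fun x y hxy => by
    refine Subtype.ext (Sigma.ext ?_ (heq_of_eq (congrArg Sigma.fst hxy)))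
    rw [← hdegree x, ← hdegree y, hxy]
  have hcomp := linearIndependent_sphHarm_natAbs_add.comp e he
  simp only [Function.comp_def, hdegree] at hcomp
  exact hcomp

/-- The pairs `(l, m)` with `l ≤ L` and `-l ≤ m ≤ l`. -/
def degreeOrder (L : ℕ) : Finset ((_ : ℕ) × ℤ) :=
  (Finset.range (L + 1)).sigma fun l => Finset.Icc (-(l : ℤ)) l

theorem card_degreeOrder (L : ℕ) : (degreeOrder L).card = (L + 1) ^ 2 := by
  rw [degreeOrder, Finset.card_sigma]
  induction L with
  | zero => rfl
  | succ n ih =>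
    rw [Finset.sum_range_succ, ih, Int.card_Icc]
    have : ((n + 1 : ℕ) + 1 - -((n + 1 : ℕ) : ℤ)).toNat = 2 * n + 3 := by omega
    rw [this]
    ring

end SphericalHarmonics

section RealFunctions

open Module

variable {X : Type*} [TopologicalSpace X] {W : Submodule ℂ C(X, ℂ)}

/-- The real functions in a complex space of functions. -/
def realFunctions (W : Submodule ℂ C(X, ℂ)) : Submodule ℝ C(X, ℝ) :=
  (W.restrictScalars ℝ).comap (Complex.ofRealCLM.compLeftContinuous ℝ X : C(X, ℝ) →ₗ[ℝ] C(X, ℂ))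

theorem comp_re_mem_realFunctions (hW : ∀ F ∈ W, star F ∈ W) {F : C(X, ℂ)} (hF : F ∈ W) :
    Complex.reCLM.compLeftContinuous ℝ X F ∈ realFunctions W := by
  have hre : Complex.ofRealCLM.compLeftContinuous ℝ X (Complex.reCLM.compLeftContinuous ℝ X F) =
      (1 / 2 : ℂ) • (F + star F) := by
    ext p
    simpa [div_eq_inv_mul] using Complex.re_eq_add_conj (F p)
  exact Submodule.mem_comap.2 (hre ▸ W.smul_mem _ (W.add_mem hF (hW F hF)))

theorem comp_im_mem_realFunctions (hW : ∀ F ∈ W, star F ∈ W) {F : C(X, ℂ)} (hF : F ∈ W) :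
    Complex.imCLM.compLeftContinuous ℝ X F ∈ realFunctions W := by
  convert comp_re_mem_realFunctions hW (W.smul_mem (-Complex.I) hF) using 1
  ext p
  simp

/-- The real and the imaginary part of the functions in a complex space of functions closed under
conjugation. -/
def reImEquiv (hW : ∀ F ∈ W, star F ∈ W) : W ≃ₗ[ℝ] realFunctions W × realFunctions W where
  toFun F := (⟨_, comp_re_mem_realFunctions hW F.2⟩, ⟨_, comp_im_mem_realFunctions hW F.2⟩)
  invFun f := ⟨Complex.ofRealCLM.compLeftContinuous ℝ X f.1 +
    Complex.I • Complex.ofRealCLM.compLeftContinuous ℝ X f.2,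
      W.add_mem f.1.2 (W.smul_mem _ f.2.2)⟩
  map_add' F G := by ext <;> simp
  map_smul' r F := by ext <;> simp
  left_inv F := by
    ext p
    simpa [mul_comm] using Complex.re_add_im (F.1 p)
  right_inv f := by ext <;> simp

theorem finiteDimensional_realFunctions [FiniteDimensional ℂ W] (hW : ∀ F ∈ W, star F ∈ W) :
    FiniteDimensional ℝ (realFunctions W) := by
  have : FiniteDimensional ℝ W := FiniteDimensional.complexToReal W
  have := Module.Finite.equiv (reImEquiv hW)
  exact .of_surjective (LinearMap.fst ℝ (realFunctions W) (realFunctions W))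
    LinearMap.fst_surjective

theorem finrank_realFunctions [FiniteDimensional ℂ W] (hW : ∀ F ∈ W, star F ∈ W) :
    finrank ℝ (realFunctions W) = finrank ℂ W := by
  have := finiteDimensional_realFunctions hW
  have hprod := (finrank_real_of_complex W).symm.trans (reImEquiv hW).finrank_eq
  rw [finrank_prod, ← two_mul] at hprod
  exact (Nat.eq_of_mul_eq_mul_left two_pos hprod).symm

end RealFunctions

section Dimension

open Module

theorem continuous_sphHarm (l : ℕ) (m : ℤ) : Continuous (sphHarm l m) := by
  have h : Continuous (sphHarmNonneg l m.natAbs) := by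
    unfold sphHarmNonneg
    fun_prop
  unfold sphHarm
  split_ifs
  · exact h
  · exact continuous_const.mul (Complex.continuous_conj.comp h)

theorem conj_sphHarm (l : ℕ) (m : ℤ) (p : S2) :
    (starRingEnd ℂ) (sphHarm l m p) = (-1) ^ m.natAbs * sphHarm l (-m) p := by
  have hsq : ((-1 : ℂ) ^ m.natAbs) * (-1) ^ m.natAbs = 1 := by rw [← mul_pow]; simp
  rcases lt_trichotomy m 0 with hm | rfl | hm
  · rw [sphHarm, sphHarm, if_neg (not_le.2 hm), if_pos (by omega), Int.natAbs_neg]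
    simp
  · simp [sphHarm, sphHarmNonneg]
  · rw [sphHarm, sphHarm, if_pos hm.le, if_neg (by omega), Int.natAbs_neg, ← mul_assoc, hsq,
      one_mul]

/-- The spherical harmonic `Y_l^m` of the pair `(l, m)`, as a continuous function. -/
def sphHarmMap (x : (_ : ℕ) × ℤ) : C(S2, ℂ) := ⟨sphHarm x.1 x.2, continuous_sphHarm x.1 x.2⟩

/-- The space of complex signals band-limited at degree `L`. -/
def complexBandLimited (L : ℕ) : Submodule ℂ C(S2, ℂ) :=
  Submodule.span ℂ (sphHarmMap '' degreeOrder L)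

theorem realFunctions_complexBandLimited (L : ℕ) :
    realFunctions (complexBandLimited L) = bandLimited L := by
  ext f
  refine (Submodule.mem_span_image_finset_iff_exists_fun' ℂ).trans ⟨?_, ?_⟩
  · rintro ⟨c, hc⟩
    refine ⟨fun l m => c ⟨l, m⟩, fun p => ?_⟩
    have hp := DFunLike.congr_fun hc p
    rw [degreeOrder, Finset.sum_sigma] at hp
    simpa [ContinuousMap.sum_apply, sphHarmMap] using hp.symm
  · rintro ⟨a, ha⟩
    refine ⟨fun x => a x.1 x.2, ContinuousMap.ext fun p => ?_⟩
    rw [degreeOrder, Finset.sum_sigma]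
    simpa [ContinuousMap.sum_apply, sphHarmMap] using (ha p).symm

theorem star_mem_complexBandLimited {L : ℕ} : ∀ F ∈ complexBandLimited L,
    star F ∈ complexBandLimited L := by
  intro F hF
  induction hF using Submodule.span_induction with
  | mem F hF =>
    obtain ⟨⟨l, m⟩, hlm, rfl⟩ := hF
    have hstar : star (sphHarmMap ⟨l, m⟩) = (-1 : ℂ) ^ m.natAbs • sphHarmMap ⟨l, -m⟩ :=
      ContinuousMap.ext (conj_sphHarm l m)
    rw [hstar]
    refine Submodule.smul_mem _ _ (Submodule.subset_span ⟨⟨l, -m⟩, ?_, rfl⟩)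
    simp only [degreeOrder, Finset.mem_coe, Finset.mem_sigma, Finset.mem_Icc] at hlm ⊢
    exact ⟨hlm.1, by omega⟩
  | zero => simp
  | add F G _ _ hF hG => simpa using Submodule.add_mem _ hF hG
  | smul c F _ hF => simpa using Submodule.smul_mem _ (star c) hF

instance finiteDimensional_complexBandLimited (L : ℕ) :
    FiniteDimensional ℂ (complexBandLimited L) :=
  FiniteDimensional.span_of_finite ℂ ((degreeOrder L).finite_toSet.image _)

theorem finrank_complexBandLimited (L : ℕ) : finrank ℂ (complexBandLimited L) = (L + 1) ^ 2 := by
  have hli : LinearIndepOn ℂ sphHarmMap (degreeOrder L) := by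
    refine .of_comp (ContinuousMap.coeFnLinearMap ℂ) (linearIndepOn_sphHarm.mono fun x hx => ?_)
    have := Finset.mem_Icc.1 (Finset.mem_sigma.1 hx).2
    simp only [Set.mem_ofPred_eq]
    omega
  rw [complexBandLimited, Set.image_eq_range]
  exact (finrank_span_eq_card hli).trans ((Fintype.card_coe _).trans (card_degreeOrder L))

instance finiteDimensional_bandLimited (L : ℕ) : FiniteDimensional ℝ (bandLimited L) :=
  realFunctions_complexBandLimited L ▸ finiteDimensional_realFunctions star_mem_complexBandLimited

theorem finrank_bandLimited (L : ℕ) : finrank ℝ (bandLimited L) = (L + 1) ^ 2 := by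
  rw [← realFunctions_complexBandLimited, finrank_realFunctions star_mem_complexBandLimited,
    finrank_complexBandLimited]

end Dimension

section Orbits

theorem exists_contDiff_of_span_range_dual_eq_top {𝕜 T V X : Type*} [NontriviallyNormedField 𝕜]
    [CompleteSpace 𝕜] [NormedAddCommGroup T] [NormedSpace 𝕜 T] [NormedAddCommGroup V]
    [NormedSpace 𝕜 V] [FiniteDimensional 𝕜 V] {n : WithTop ℕ∞} {ev : X → Module.Dual 𝕜 V}
    (hev : Submodule.span 𝕜 (Set.range ev) = ⊤) {u : T → X → 𝕜}
    (hu : ∀ p, ContDiff 𝕜 n fun t => u t p) :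
    ∃ Γ : T → V, ContDiff 𝕜 n Γ ∧ ∀ t v, (∀ p, ev p v = u t p) → Γ t = v := by
  let b := Module.finBasis 𝕜 V
  have hcoord i : ∃ c : X →₀ 𝕜, (c.sum fun p r => r • ev p) = b.coord i :=
    Finsupp.mem_span_range_iff_exists_finsupp.1 (hev ▸ Submodule.mem_top)
  choose c hc using hcoord
  refine ⟨fun t => b.equivFunL.symm fun i => ∑ p ∈ (c i).support, c i p * u t p,
    b.equivFunL.symm.contDiff.comp (contDiff_pi.2 fun i => ContDiff.sum fun p _ =>
      contDiff_const.mul (hu p)), fun t v hv => ?_⟩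
  rw [ContinuousLinearEquiv.symm_apply_eq]
  ext i
  rw [Module.Basis.equivFunL_apply, ← b.coord_apply, ← hc]
  simp [Finsupp.sum, hv]

/-- Evaluation at a point, as a linear form on a space of functions. -/
def evalDual {X : Type*} [TopologicalSpace X] (V : Submodule ℝ C(X, ℝ)) (p : X) :
    Module.Dual ℝ V :=
  (ContinuousMap.evalCLM ℝ p).toLinearMap ∘ₗ V.subtype

theorem span_range_evalDual {X : Type*} [TopologicalSpace X] (V : Submodule ℝ C(X, ℝ))
    [FiniteDimensional ℝ V] : Submodule.span ℝ (Set.range (evalDual V)) = ⊤ := by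
  refine Submodule.span_eq_top_of_ne_zero fun f hf => ?_
  contrapose! hf
  exact Subtype.ext (ContinuousMap.ext fun p => hf _ ⟨p, rfl⟩)

variable {T : Type*} [NormedAddCommGroup T] [NormedSpace ℝ T] {n : WithTop ℕ∞}

theorem contDiff_sphHarm_comp {c : T → S2}
    (hc : ContDiff ℝ n fun t => (c t : EuclideanSpace ℝ (Fin 3))) (l : ℕ) (m : ℤ) :
    ContDiff ℝ n fun t => sphHarm l m (c t) := by
  have hcoord i : ContDiff ℝ n fun t => (c t : EuclideanSpace ℝ (Fin 3)) i :=
    contDiff_euclidean.1 hc i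
  have hcoordC i : ContDiff ℝ n fun t => ((c t : EuclideanSpace ℝ (Fin 3)) i : ℂ) :=
    Complex.ofRealCLM.contDiff.comp (hcoord i)
  have hN : ContDiff ℝ n fun t => sphHarmNonneg l m.natAbs (c t) := by
    refine (contDiff_const.mul (Complex.ofRealCLM.contDiff.comp ?_)).mul
      (((hcoordC 0).add (contDiff_const.mul (hcoordC 1))).pow _)
    exact (Polynomial.contDiff_aeval (𝕜 := ℝ) _ n).comp (hcoord 2)
  by_cases hm : 0 ≤ m
  · simpa only [sphHarm, if_pos hm] using hN
  · simp only [sphHarm, if_neg hm]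
    exact contDiff_const.mul (Complex.conjCLE.contDiff.comp hN)

theorem contDiff_bandLimited_comp {L : ℕ} (f : bandLimited L) {c : T → S2}
    (hc : ContDiff ℝ n fun t => (c t : EuclideanSpace ℝ (Fin 3))) :
    ContDiff ℝ n fun t => f.1 (c t) := by
  obtain ⟨a, ha⟩ := f.2
  have hre : (fun t => f.1 (c t)) = fun t => (∑ l ∈ Finset.range (L + 1),
      ∑ m ∈ Finset.Icc (-(l : ℤ)) (l : ℤ), a l m * sphHarm l m (c t)).re :=
    funext fun t => by rw [← ha, Complex.ofReal_re]
  rw [hre]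
  exact Complex.reCLM.contDiff.comp (ContDiff.sum fun l _ => ContDiff.sum fun m _ =>
    contDiff_const.mul (contDiff_sphHarm_comp hc l m))

theorem exists_contDiff_orbit_subset_range {L : ℕ} (f : bandLimited L) :
    ∃ Γ : ℝ × ℝ × ℝ → bandLimited L, ContDiff ℝ n Γ ∧
      {f' : bandLimited L | ∃ g, (f' : C(S2, ℝ)) = rotate g f} ⊆ Set.range Γ := by
  obtain ⟨Γ, hΓ, hΓ_eq⟩ := exists_contDiff_of_span_range_dual_eq_top (V := bandLimited L)
    (span_range_evalDual (bandLimited L)) fun p =>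
      contDiff_bandLimited_comp f (contDiff_rotatePoint_rotZ_mul_rotY_mul_rotZ (n := n) p)
  refine ⟨Γ, hΓ, fun f' ⟨g, hg⟩ => ?_⟩
  obtain ⟨a, b, c, habc⟩ := exists_eq_rotZ_mul_rotY_mul_rotZ g⁻¹
  refine ⟨(a, b, c), hΓ_eq _ f' fun p => ?_⟩
  have hp := DFunLike.congr_fun hg p
  rwa [← habc]

end Orbits

section LowerBound

open Module

variable {L k : ℕ} {Φ : bandLimited L → EuclideanSpace ℝ (Fin k)}

theorem sq_le_of_separatesOrbitsOn {U : Set (bandLimited L)} (hU : IsOpen U) (hne : U.Nonempty)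
    (hΦ : ContDiffOn ℝ 1 Φ U) (hsep : SeparatesOrbitsOn Φ U) : (L + 1) ^ 2 ≤ k + 3 := by
  have hfibre : ∀ f ∈ U, ∃ Γ : ℝ × ℝ × ℝ → bandLimited L,
      ContDiff ℝ 1 Γ ∧ U ∩ Φ ⁻¹' {Φ f} ⊆ Set.range Γ := by
    intro f hf
    obtain ⟨Γ, hΓ, horbit⟩ := exists_contDiff_orbit_subset_range f
    exact ⟨Γ, hΓ, fun f' hf' => horbit (hsep f hf f' hf'.1 hf'.2.symm)⟩
  simpa [finrank_bandLimited] using finrank_le_of_fibre_subset_range hU hne hΦ hfibre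

theorem IsCompleteInvariant.contDiff (h : IsCompleteInvariant L k Φ) :
    ContDiff ℝ ((⊤ : ℕ∞) : WithTop ℕ∞) Φ :=
  h.smooth_or_polynomial.elim id fun hp =>
    contDiff_euclidean.2 fun i => contDiff_of_mem_polyFun (hp i)

theorem IsCompleteInvariant.exists_isOpen_separatesOrbitsOn (h : IsCompleteInvariant L k Φ) :
    ∃ U : Set (bandLimited L),
      IsOpen U ∧ U.Nonempty ∧ ContDiffOn ℝ 1 Φ U ∧ SeparatesOrbitsOn Φ U := by
  obtain ⟨U, hU, hdense, hsep⟩ := h.separates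
  have hne : U.Nonempty := @Dense.nonempty _ (zariskiTopology (bandLimited L)) _ _ hdense
  have hΦ : ContDiff ℝ 1 Φ := h.contDiff.of_le (by exact_mod_cast le_top)
  exact ⟨U, isOpen_of_isOpen_zariski (V := bandLimited L) hU, hne, hΦ.contDiffOn, hsep⟩

theorem mainTheorem1_general :
    (∀ L : ℕ, finrank ℝ (bandLimited L) = (L + 1) ^ 2) ∧
    (∀ (L k : ℕ) (Φ : bandLimited L → EuclideanSpace ℝ (Fin k)),
      (∃ U : Set (bandLimited L),
        IsOpen U ∧ U.Nonempty ∧ ContDiffOn ℝ 1 Φ U ∧ SeparatesOrbitsOn Φ U) →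
      ((L : ℤ) + 1) ^ 2 - 3 ≤ (k : ℤ)) ∧
    (∃ c : ℝ, 0 < c ∧ ∃ L₀ : ℕ, ∀ L : ℕ, L₀ ≤ L →
      ∀ (k : ℕ) (Φ : bandLimited L → EuclideanSpace ℝ (Fin k)),
      (∃ U : Set (bandLimited L),
        IsOpen U ∧ U.Nonempty ∧ ContDiffOn ℝ 1 Φ U ∧ SeparatesOrbitsOn Φ U) →
      c * (L : ℝ) ^ 2 ≤ (k : ℝ)) := by
  refine ⟨finrank_bandLimited, ?_, 1, one_pos, 1, ?_⟩
  · rintro L k Φ ⟨U, hU, hne, hΦ, hsep⟩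
    have hbound : ((L : ℤ) + 1) ^ 2 ≤ k + 3 := by
      exact_mod_cast sq_le_of_separatesOrbitsOn hU hne hΦ hsep
    linarith
  · rintro L hL k Φ ⟨U, hU, hne, hΦ, hsep⟩
    have hbound : ((L : ℝ) + 1) ^ 2 ≤ k + 3 := by
      exact_mod_cast sq_le_of_separatesOrbitsOn hU hne hΦ hsep
    have hL' : (1 : ℝ) ≤ L := by exact_mod_cast hL
    linarith

end LowerBound

end

theorem mainTheorem1 :
    (∀ L : ℕ, Module.finrank ℝ (bandLimited L) = (L + 1) ^ 2) ∧
    (∀ (L k : ℕ) (Φ : bandLimited L → EuclideanSpace ℝ (Fin k)),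
      IsCompleteInvariant L k Φ → ((L : ℤ) + 1) ^ 2 - 3 ≤ (k : ℤ)) ∧
    (∃ c : ℝ, 0 < c ∧ ∃ L₀ : ℕ, ∀ L : ℕ, L₀ ≤ L →
      ∀ (k : ℕ) (Φ : bandLimited L → EuclideanSpace ℝ (Fin k)),
        IsCompleteInvariant L k Φ → c * (L : ℝ) ^ 2 ≤ (k : ℝ)) := by
  obtain ⟨hdim, hbound, c, hc, L₀, hquad⟩ := mainTheorem1_general
  exact ⟨hdim, fun L k Φ h => hbound L k Φ h.exists_isOpen_separatesOrbitsOn, c, hc, L₀,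
    fun L hL k Φ h => hquad L hL k Φ h.exists_isOpen_separatesOrbitsOn⟩
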